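/- Let $Ag$ be a non-empty finite set of agents and $Var$ a countably infinite set of propositional variables. Consider the formulas given by $\varphi ::= p \mid \neg\varphi \mid \varphi\land\varphi \mid I_a\varphi \mid K_a\varphi \mid B_a\varphi$ with $p\in Var$ and $a\in Ag$, where $\varphi\lor\psi:=\neg(\neg\varphi\land\neg\psi)$ and $\varphi\to\psi:=\neg\varphi\lor\psi$. Let $\mathsf S$ be the logic whose theorems are the formulas derivable from the following axiom schemes (for all formulas $\varphi,\psi$ and all $a\in Ag$): all instances of tautologies of classical propositional logic; $\star(\varphi\to\psi)\to(\star\varphi\to\star\psi)$ for $\star\in\{I_a,K_a,B_a\}$; $K_a\varphi\to\varphi$; $K_a\varphi\to K_aK_a\varphi$; $B_a\varphi\to\neg B_a\neg\varphi$; $K_a\varphi\to B_a\varphi$; $B_a\varphi\to K_aB_a\varphi$; $I_a\varphi\to\neg I_a\neg\varphi$; $I_a\varphi\to K_aI_a\varphi$; $I_a\varphi\to I_aK_a\varphi$; $I_a\varphi\to I_aI_a\varphi$; by the rules of modus ponens (from $\varphi$ and $\varphi\to\psi$ infer $\psi$) and necessitation (from $\varphi$ infer $\star\varphi$, for $\star\in\{I_a,K_a,B_a\}$).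 Then $\mathsf S$ is decidable: under a standard Gödel numbering of the formulas (built from any enumerations of $Ag$ and of $Var$), the set of Gödel numbers of theorems of $\mathsf S$ is recursive. -/

import Mathlib

namespace TrueSecrets

/-- The three kinds of modal operators: intention, knowledge, belief. -/
inductive Modality : Type
  | I
  | K
  | B

/-- Formulas `φ := p | ¬φ | φ ∧ φ | I_a φ | K_a φ | B_a φ`, with `p` a variable and `a` an agent;
`box s a φ` is the modal formula with operator `s ∈ {I, K, B}` and agent `a`. -/
inductive Formula (Ag : Type*) (Var : Type*)
  | var (p : Var) : Formula Ag Var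
  | neg (φ : Formula Ag Var) : Formula Ag Var
  | and (φ ψ : Formula Ag Var) : Formula Ag Var
  | box (s : Modality) (a : Ag) (φ : Formula Ag Var) : Formula Ag Var

namespace Formula

variable {Ag Var : Type*}

/-- `φ ∨ ψ := ¬(¬φ ∧ ¬ψ)`. -/
def or (φ ψ : Formula Ag Var) : Formula Ag Var := neg (and (neg φ) (neg ψ))

/-- `φ → ψ := ¬φ ∨ ψ`. -/
def imp (φ ψ : Formula Ag Var) : Formula Ag Var := or (neg φ) ψ

/-- `I_a φ`: agent `a` intends `φ`. -/
abbrev intends (a : Ag) (φ : Formula Ag Var) : Formula Ag Var := box Modality.I a φ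

/-- `K_a φ`: agent `a` knows `φ`. -/
abbrev knows (a : Ag) (φ : Formula Ag Var) : Formula Ag Var := box Modality.K a φ

/-- `B_a φ`: agent `a` believes `φ`. -/
abbrev believes (a : Ag) (φ : Formula Ag Var) : Formula Ag Var := box Modality.B a φ

/-- Classical truth-table evaluation, where variables and modal formulas are treated as
propositional atoms whose truth values are given by `v`. -/
def boolEval (v : Formula Ag Var → Bool) : Formula Ag Var → Bool
  | var p => v (var p)
  | neg φ => !(boolEval v φ)
  | and φ ψ => boolEval v φ && boolEval v ψ
  | box s a φ => v (box s a φ)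

/-- (Substitution instances of) tautologies of classical propositional logic. -/
def IsTautology (φ : Formula Ag Var) : Prop := ∀ v : Formula Ag Var → Bool, boolEval v φ = true

end Formula

open Formula in
/-- Theoremhood `⊢ φ` in the Hilbert system of the logic `S`. -/
inductive Provable {Ag Var : Type*} : Formula Ag Var → Prop
  | A1 (φ : Formula Ag Var) (h : IsTautology φ) : Provable φ
  | A2 (s : Modality) (a : Ag) (φ ψ : Formula Ag Var) :
      Provable (imp (box s a (imp φ ψ)) (imp (box s a φ) (box s a ψ)))
  | A3 (a : Ag) (φ : Formula Ag Var) : Provable (imp (knows a φ) φ)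
  | A4 (a : Ag) (φ : Formula Ag Var) : Provable (imp (knows a φ) (knows a (knows a φ)))
  | A5 (a : Ag) (φ : Formula Ag Var) : Provable (imp (believes a φ) (neg (believes a (neg φ))))
  | A6 (a : Ag) (φ : Formula Ag Var) : Provable (imp (knows a φ) (believes a φ))
  | A7 (a : Ag) (φ : Formula Ag Var) : Provable (imp (believes a φ) (knows a (believes a φ)))
  | A8 (a : Ag) (φ : Formula Ag Var) : Provable (imp (intends a φ) (neg (intends a (neg φ))))
  | A9 (a : Ag) (φ : Formula Ag Var) : Provable (imp (intends a φ) (knows a (intends a φ)))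
  | A10 (a : Ag) (φ : Formula Ag Var) : Provable (imp (intends a φ) (intends a (knows a φ)))
  | A11 (a : Ag) (φ : Formula Ag Var) : Provable (imp (intends a φ) (intends a (intends a φ)))
  | RMP (φ ψ : Formula Ag Var) (h₁ : Provable φ) (h₂ : Provable (imp φ ψ)) : Provable ψ
  | RN (s : Modality) (a : Ag) (φ : Formula Ag Var) (h : Provable φ) : Provable (box s a φ)

namespace Formula

variable {Ag Var : Type*} {n : ℕ}

/-- The Gödel number of a formula, for a numbering `eA` of the `n` agents by `0, …, n - 1` and a
numbering `eV` of the variables by the natural numbers. The remainder modulo `6` is the outermost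
symbol; `Nat.pair` is a computable pairing bijection. -/
def code (eA : Ag ≃ Fin n) (eV : Var ≃ ℕ) : Formula Ag Var → ℕ
  | var p => 6 * eV p
  | neg φ => 6 * code eA eV φ + 1
  | and φ ψ => 6 * Nat.pair (code eA eV φ) (code eA eV ψ) + 2
  | box Modality.I a φ => 6 * (n * code eA eV φ + eA a) + 3
  | box Modality.K a φ => 6 * (n * code eA eV φ + eA a) + 4
  | box Modality.B a φ => 6 * (n * code eA eV φ + eA a) + 5

theorem code_injective (eA : Ag ≃ Fin n) (eV : Var ≃ ℕ) :
    Function.Injective (code eA eV) := by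
  have key : ∀ (a b : Ag) (x y : ℕ), n * x + (eA a : ℕ) = n * y + (eA b : ℕ) → x = y ∧ a = b := by
    intro a b x y h
    have ha := (eA a).isLt
    have hb := (eA b).isLt
    have hn : 0 < n := by omega
    have h1 := congrArg (· / n) h
    have h2 := congrArg (· % n) h
    simp only [Nat.mul_add_div hn, Nat.div_eq_of_lt ha, Nat.div_eq_of_lt hb] at h1
    simp only [Nat.mul_add_mod, Nat.mod_eq_of_lt ha, Nat.mod_eq_of_lt hb] at h2
    exact ⟨by omega, eA.injective (Fin.ext h2)⟩
  intro φ
  induction φ with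
  | var p =>
    intro ψ h
    rcases ψ with q | _ | _ | ⟨_ | _ | _, _, _⟩ <;> simp only [code] at h <;> try omega
    rw [eV.injective (show eV p = eV q by omega)]
  | neg φ ih =>
    intro ψ h
    rcases ψ with q | _ | _ | ⟨_ | _ | _, _, _⟩ <;> simp only [code] at h <;> try omega
    exact congrArg neg (ih (Nat.eq_of_mul_eq_mul_left (by norm_num) (Nat.add_right_cancel h)))
  | and φ₁ φ₂ ih₁ ih₂ =>
    intro ψ h
    rcases ψ with q | _ | _ | ⟨_ | _ | _, _, _⟩ <;> simp only [code] at h <;> try omega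
    have h' := Nat.pair_eq_pair.1
      (Nat.eq_of_mul_eq_mul_left (by norm_num) (Nat.add_right_cancel h))
    rw [ih₁ h'.1, ih₂ h'.2]
  | box s a φ ih =>
    intro ψ h
    rcases s with _ | _ | _ <;>
    rcases ψ with q | _ | _ | ⟨_ | _ | _, b, _⟩ <;> simp only [code] at h <;> try omega
    all_goals
      have h' := key _ _ _ _ (Nat.eq_of_mul_eq_mul_left (by norm_num) (Nat.add_right_cancel h))
      rw [ih h'.1, h'.2]

theorem code_surjective [NeZero n] (eA : Ag ≃ Fin n) (eV : Var ≃ ℕ) :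
    Function.Surjective (code eA eV) := by
  intro m
  induction m using Nat.strong_induction_on with
  | _ m ih =>
    have hn : 0 < n := Nat.pos_of_ne_zero (NeZero.ne n)
    have hm : 6 * (m / 6) + m % 6 = m := Nat.div_add_mod m 6
    have hr : m % 6 < 6 := Nat.mod_lt _ (by norm_num)
    by_cases h0 : m % 6 = 0
    · exact ⟨var (eV.symm (m / 6)), by simp only [code, Equiv.apply_symm_apply]; omega⟩
    have hlt : m / 6 < m := by omega
    by_cases h1 : m % 6 = 1
    · obtain ⟨φ, hφ⟩ := ih (m / 6) hlt
      exact ⟨neg φ, by simp only [code, hφ]; omega⟩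
    by_cases h2 : m % 6 = 2
    · obtain ⟨φ, hφ⟩ := ih (m / 6).unpair.1 (lt_of_le_of_lt (Nat.unpair_left_le _) hlt)
      obtain ⟨ψ, hψ⟩ := ih (m / 6).unpair.2 (lt_of_le_of_lt (Nat.unpair_right_le _) hlt)
      exact ⟨and φ ψ, by simp only [code, hφ, hψ, Nat.pair_unpair]; omega⟩
    obtain ⟨φ, hφ⟩ := ih (m / 6 / n) (lt_of_le_of_lt (Nat.div_le_self _ _) hlt)
    have hq : n * (m / 6 / n) + m / 6 % n = m / 6 := Nat.div_add_mod _ _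
    let a : Ag := eA.symm ⟨m / 6 % n, Nat.mod_lt _ hn⟩
    have ha : ((eA a : Fin n) : ℕ) = m / 6 % n := by simp [a]
    have h345 : m % 6 = 3 ∨ m % 6 = 4 ∨ m % 6 = 5 := by omega
    rcases h345 with h | h | h
    · exact ⟨box Modality.I a φ, by simp only [code, hφ, ha, hq]; omega⟩
    · exact ⟨box Modality.K a φ, by simp only [code, hφ, ha, hq]; omega⟩
    · exact ⟨box Modality.B a φ, by simp only [code, hφ, ha, hq]; omega⟩

/-- The bijective Gödel numbering of formulas. -/
noncomputable def goedel [NeZero n] (eA : Ag ≃ Fin n) (eV : Var ≃ ℕ) : Formula Ag Var ≃ ℕ :=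
  Equiv.ofBijective (code eA eV) ⟨code_injective eA eV, code_surjective eA eV⟩

end Formula

end TrueSecrets

namespace TrueSecrets

open Formula hiding and or

/-! ### Kripke semantics and soundness -/

/-! The logic has an effective finite model property: a formula of code `m` is unprovable exactly
when it fails in a model whose worlds are sets of formulas of code below `L`, the least multiple of
6 above `m`. There are at most `2 ^ 2 ^ L` such sets of worlds, and all conditions on them are
bounded arithmetic, so unprovability is primitive recursive (`primrecPred_refutable`,
`refutable_iff_not_provable`).

The formulas of code below `L` form a finite set closed under subformulas and, as 6 divides `L`,
under exchanging the outermost modality of a boxed formula. Accessibility is read off the sets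
themselves: a successor must contain what the axioms force from the boxes at the source. This builds
most frame conditions into the relations (`isFrame_codedRel`), and a truth lemma
(`holds_codedRel_iff`) with soundness shows that a refutable formula is unprovable.

Conversely, since only finitely many formulas matter, a single consistent formula deciding all of
them replaces a maximal consistent set. The traces of these formulas form a coded model
(`isWorld_of_isTrace`), and an unprovable formula is false at one of its worlds. -/

/-- The frame conditions corresponding to the axioms of `S`. -/
structure IsFrame {Ag W : Type*} (R : Modality → Ag → W → W → Prop) : Prop where
  refl_K : ∀ a x, R .K a x x
  trans_K : ∀ a x y z, R .K a x y → R .K a y z → R .K a x z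
  serial_B : ∀ a x, ∃ y, R .B a x y
  B_le_K : ∀ a x y, R .B a x y → R .K a x y
  K_B : ∀ a x y z, R .K a x y → R .B a y z → R .B a x z
  serial_I : ∀ a x, ∃ y, R .I a x y
  K_I : ∀ a x y z, R .K a x y → R .I a y z → R .I a x z
  I_K : ∀ a x y z, R .I a x y → R .K a y z → R .I a x z
  trans_I : ∀ a x y z, R .I a x y → R .I a y z → R .I a x z

/-- Truth of a formula at a world of a Kripke model. -/
def Holds {Ag Var W : Type*} (R : Modality → Ag → W → W → Prop) (V : Var → W → Prop) :
    Formula Ag Var → W → Prop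
  | var p, w => V p w
  | neg φ, w => ¬ Holds R V φ w
  | .and φ ψ, w => Holds R V φ w ∧ Holds R V ψ w
  | box s a φ, w => ∀ u, R s a w u → Holds R V φ u

section Soundness

variable {Ag Var W : Type*} {R : Modality → Ag → W → W → Prop} {V : Var → W → Prop}

theorem holds_imp (φ ψ : Formula Ag Var) (w : W) :
    Holds R V (imp φ ψ) w ↔ (Holds R V φ w → Holds R V ψ w) := by
  simp only [imp, Formula.or, Holds]
  tauto

open Classical in
-- Truth at a world is itself a Boolean valuation of variables and boxed formulas, so tautologies
-- are valid.
theorem boolEval_holds (φ : Formula Ag Var) (w : W) :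
    boolEval (fun ψ => decide (Holds R V ψ w)) φ = true ↔ Holds R V φ w := by
  induction φ with
  | var p => simp [boolEval]
  | neg φ ih => simp [boolEval, Holds, ← ih]
  | and φ ψ ih₁ ih₂ => simp [boolEval, Holds, ← ih₁, ← ih₂]
  | box s a φ => simp [boolEval]

/-- Theorems of `S` are true at every world of every model based on a frame for `S`. -/
theorem Provable.holds (hR : IsFrame R) {φ : Formula Ag Var} (h : Provable φ) (w : W) :
    Holds R V φ w := by
  induction h generalizing w with
  | A1 φ h =>
    classical
    exact (boolEval_holds φ w).1 (h _)
  | A2 s a φ ψ =>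
    simp only [holds_imp, Holds]
    exact fun h₁ h₂ u hu => h₁ u hu (h₂ u hu)
  | A3 a φ =>
    simp only [holds_imp, Holds]
    exact fun h => h w (hR.refl_K a w)
  | A4 a φ =>
    simp only [holds_imp, Holds]
    exact fun h u hu v hv => h v (hR.trans_K a w u v hu hv)
  | A5 a φ =>
    simp only [holds_imp, Holds]
    obtain ⟨u, hu⟩ := hR.serial_B a w
    exact fun h h' => h' u hu (h u hu)
  | A6 a φ =>
    simp only [holds_imp, Holds]
    exact fun h u hu => h u (hR.B_le_K a w u hu)
  | A7 a φ =>
    simp only [holds_imp, Holds]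
    exact fun h u hu v hv => h v (hR.K_B a w u v hu hv)
  | A8 a φ =>
    simp only [holds_imp, Holds]
    obtain ⟨u, hu⟩ := hR.serial_I a w
    exact fun h h' => h' u hu (h u hu)
  | A9 a φ =>
    simp only [holds_imp, Holds]
    exact fun h u hu v hv => h v (hR.K_I a w u v hu hv)
  | A10 a φ =>
    simp only [holds_imp, Holds]
    exact fun h u hu v hv => h v (hR.I_K a w u v hu hv)
  | A11 a φ =>
    simp only [holds_imp, Holds]
    exact fun h u hu v hv => h v (hR.trans_I a w u v hu hv)
  | RMP φ ψ _ _ ih₁ ih₂ => exact (holds_imp φ ψ w).1 (ih₂ w) (ih₁ w)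
  | RN s a φ _ ih => exact fun u _ => ih u

end Soundness

/-! ### Arithmetical coding of finite models

A number `i < 2 ^ L` codes the world at which exactly the formulas `k < L` with `i.testBit k` are
true, and a number `N < 2 ^ 2 ^ L` codes the set of the worlds `i` with `N.testBit i`. -/

/-- The remainder modulo `6` of the Gödel numbers of the formulas `box s a φ`. -/
def Modality.symbol : Modality → ℕ
  | I => 3
  | K => 4
  | B => 5

/-- The accessibility relations between coded worlds. -/
def Sees (n L : ℕ) : Modality → ℕ → ℕ → ℕ → Prop
  | .I, a, i, j => ∀ k < L, k % 6 = 3 → k / 6 % n = a → i.testBit k →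
      j.testBit k ∧ j.testBit (k + 1) ∧ j.testBit (k / 6 / n)
  | .K, a, i, j => ∀ k < L, 3 ≤ k % 6 → k / 6 % n = a → i.testBit k →
      j.testBit k ∧ (k % 6 = 4 → j.testBit (k / 6 / n))
  | .B, a, i, j => ∀ k < L, 3 ≤ k % 6 → k / 6 % n = a → i.testBit k →
      j.testBit k ∧ (k % 6 = 4 ∨ k % 6 = 5 → j.testBit (k / 6 / n))

/-- The bits of `i` obey the truth conditions of the connectives relative to the worlds in `N`,
and `i` has the successors that the frame conditions require. -/
def IsWorld (n L N i : ℕ) : Prop :=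
  (∀ k < L, k % 6 = 1 → (i.testBit k ↔ ¬ i.testBit (k / 6))) ∧
  (∀ k < L, k % 6 = 2 →
    (i.testBit k ↔ i.testBit (k / 6).unpair.1 ∧ i.testBit (k / 6).unpair.2)) ∧
  (∀ a < n, Sees n L .K a i i) ∧
  (∀ a < n, ∃ j < 2 ^ L, N.testBit j ∧ Sees n L .B a i j) ∧
  (∀ a < n, ∃ j < 2 ^ L, N.testBit j ∧ Sees n L .I a i j) ∧
  ∀ s : Modality, ∀ k < L, k % 6 = s.symbol →
    (∀ j < 2 ^ L, N.testBit j → Sees n L s (k / 6 % n) i j → j.testBit (k / 6 / n)) → i.testBit k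

/-- The formula with Gödel number `m` is false at a world of a coded model, in which the truth of
the formulas below the least multiple of `6` above `m` is recorded. -/
def Refutable (n m : ℕ) : Prop :=
  ∃ N < 2 ^ 2 ^ (6 * (m / 6 + 1)),
    (∀ i < 2 ^ (6 * (m / 6 + 1)), N.testBit i → IsWorld n (6 * (m / 6 + 1)) N i) ∧
    ∃ i < 2 ^ (6 * (m / 6 + 1)), N.testBit i ∧ ¬ i.testBit m

/-! ### Primitive recursiveness of refutability -/

section Primrec

variable {α : Type*} [Primcodable α]

theorem primrecPred_forall_lt {f : α → ℕ} {p : α → ℕ → Prop} (hf : Primrec f)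
    (hp : PrimrecPred fun x : α × ℕ => p x.1 x.2) : PrimrecPred fun x => ∀ k < f x, p x k :=
  ((PrimrecRel.forall_mem_list (R := fun k x => p x k)
    (hp.comp (Primrec.snd.pair Primrec.fst))).comp (Primrec.list_range.comp hf)
      Primrec.id).of_eq (by simp)

theorem primrecPred_exists_lt {f : α → ℕ} {p : α → ℕ → Prop} (hf : Primrec f)
    (hp : PrimrecPred fun x : α × ℕ => p x.1 x.2) : PrimrecPred fun x => ∃ k < f x, p x k :=
  ((PrimrecRel.exists_mem_list (R := fun k x => p x k)
    (hp.comp (Primrec.snd.pair Primrec.fst))).comp (Primrec.list_range.comp hf)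
      Primrec.id).of_eq (by simp)

theorem primrecPred_imp {p q : α → Prop} (hp : PrimrecPred p) (hq : PrimrecPred q) :
    PrimrecPred fun x => p x → q x :=
  (hp.not.or hq).of_eq fun _ => by tauto

theorem primrecPred_iff {p q : α → Prop} (hp : PrimrecPred p) (hq : PrimrecPred q) :
    PrimrecPred fun x => p x ↔ q x :=
  ((primrecPred_imp hp hq).and (primrecPred_imp hq hp)).of_eq fun _ => by tauto

theorem primrecPred_eq {f g : α → ℕ} (hf : Primrec f) (hg : Primrec g) :
    PrimrecPred fun x => f x = g x :=
  Primrec.eq.comp hf hg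

theorem primrec_two_pow {f : α → ℕ} (hf : Primrec f) : Primrec fun x => 2 ^ f x :=
  ((Primrec₂.unpaired'.1 Nat.Primrec.pow).comp (Primrec.const 2) hf)

theorem primrecPred_testBit {f g : α → ℕ} (hf : Primrec f) (hg : Primrec g) :
    PrimrecPred fun x => (f x).testBit (g x) = true :=
  (primrecPred_eq (Primrec.nat_mod.comp (Primrec.nat_div.comp hf (primrec_two_pow hg))
    (Primrec.const 2)) (Primrec.const 1)).of_eq fun x => by
      simp [Nat.testBit_eq_decide_div_mod_eq]

theorem primrec_div_const {f : α → ℕ} (hf : Primrec f) (c : ℕ) : Primrec fun x => f x / c :=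
  Primrec.nat_div.comp hf (Primrec.const c)

theorem primrec_mod_const {f : α → ℕ} (hf : Primrec f) (c : ℕ) : Primrec fun x => f x % c :=
  Primrec.nat_mod.comp hf (Primrec.const c)

theorem primrecPred_sees (n : ℕ) (s : Modality) {L a i j : α → ℕ} (hL : Primrec L)
    (ha : Primrec a) (hi : Primrec i) (hj : Primrec j) :
    PrimrecPred fun x => Sees n (L x) s (a x) (i x) (j x) := by
  have hk : Primrec fun x : α × ℕ => x.2 := Primrec.snd
  have hmod := primrec_mod_const hk 6
  have hbody := primrec_div_const (primrec_div_const hk 6) n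
  have hagent := primrecPred_eq (primrec_mod_const (primrec_div_const hk 6) n)
    (ha.comp Primrec.fst)
  have hle : PrimrecPred fun x : α × ℕ => 3 ≤ x.2 % 6 :=
    Primrec.nat_le.comp (Primrec.const 3) hmod
  have hik := primrecPred_testBit (hi.comp Primrec.fst) hk
  have hjk := primrecPred_testBit (hj.comp Primrec.fst) hk
  have hjbody := primrecPred_testBit (hj.comp Primrec.fst) hbody
  cases s
  · exact primrecPred_forall_lt hL (primrecPred_imp (primrecPred_eq hmod (Primrec.const 3))
      (primrecPred_imp hagent (primrecPred_imp hik (hjk.and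
        ((primrecPred_testBit (hj.comp Primrec.fst) (Primrec.succ.comp hk)).and hjbody)))))
  · exact primrecPred_forall_lt hL (primrecPred_imp hle (primrecPred_imp hagent
      (primrecPred_imp hik (hjk.and
        (primrecPred_imp (primrecPred_eq hmod (Primrec.const 4)) hjbody)))))
  · exact primrecPred_forall_lt hL (primrecPred_imp hle (primrecPred_imp hagent
      (primrecPred_imp hik (hjk.and
        (primrecPred_imp ((primrecPred_eq hmod (Primrec.const 4)).or
          (primrecPred_eq hmod (Primrec.const 5))) hjbody)))))

theorem primrecPred_forall_modality {p : Modality → α → Prop} (hp : ∀ s, PrimrecPred (p s)) :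
    PrimrecPred fun x => ∀ s, p s x :=
  ((hp .I).and ((hp .K).and (hp .B))).of_eq fun x =>
    ⟨fun h s => by cases s <;> tauto, fun h => ⟨h _, h _, h _⟩⟩

theorem primrecPred_isWorld (n : ℕ) {L N i : α → ℕ} (hL : Primrec L) (hN : Primrec N)
    (hi : Primrec i) : PrimrecPred fun x => IsWorld n (L x) (N x) (i x) := by
  have hk : Primrec fun x : α × ℕ => x.2 := Primrec.snd
  have hmod := primrec_mod_const hk 6
  have hdiv := primrec_div_const hk 6
  have hi' : Primrec fun x : α × ℕ => i x.1 := hi.comp Primrec.fst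
  have hL' : Primrec fun x : α × ℕ => L x.1 := hL.comp Primrec.fst
  have hik := primrecPred_testBit hi' hk
  have hNj : PrimrecPred fun x : (α × ℕ) × ℕ => (N x.1.1).testBit x.2 = true :=
    primrecPred_testBit (hN.comp (Primrec.fst.comp Primrec.fst)) Primrec.snd
  have hserial : ∀ s : Modality, PrimrecPred fun x => ∀ a < n, ∃ j < 2 ^ L x,
      (N x).testBit j ∧ Sees n (L x) s a (i x) j := fun s =>
    primrecPred_forall_lt (Primrec.const n) (primrecPred_exists_lt (primrec_two_pow hL')
      (hNj.and (primrecPred_sees n s (hL'.comp Primrec.fst) (hk.comp Primrec.fst)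
        (hi'.comp Primrec.fst) Primrec.snd)))
  have hrefl : PrimrecPred fun x => ∀ a < n, Sees n (L x) .K a (i x) (i x) :=
    primrecPred_forall_lt (Primrec.const n) (primrecPred_sees n .K hL' hk hi' hi')
  refine (primrecPred_forall_lt hL (primrecPred_imp (primrecPred_eq hmod (Primrec.const 1))
    (primrecPred_iff hik (primrecPred_testBit hi' hdiv).not))).and <|
    (primrecPred_forall_lt hL (primrecPred_imp (primrecPred_eq hmod (Primrec.const 2))
      (primrecPred_iff hik
        ((primrecPred_testBit hi' (Primrec.fst.comp (Primrec.unpair.comp hdiv))).and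
          (primrecPred_testBit hi' (Primrec.snd.comp (Primrec.unpair.comp hdiv))))))).and <|
    hrefl.and <|
    (hserial .B).and <| (hserial .I).and <| primrecPred_forall_modality fun s => ?_
  exact primrecPred_forall_lt hL (primrecPred_imp
    (primrecPred_eq hmod (Primrec.const s.symbol)) (primrecPred_imp
      (primrecPred_forall_lt (primrec_two_pow hL') (primrecPred_imp hNj (primrecPred_imp
        (primrecPred_sees n s (hL'.comp Primrec.fst)
          ((primrec_mod_const hdiv n).comp Primrec.fst) (hi'.comp Primrec.fst) Primrec.snd)
        (primrecPred_testBit Primrec.snd ((primrec_div_const hdiv n).comp Primrec.fst))))) hik))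

/-- Every numerical quantifier has a primitive recursive bound, and the quantifier over modalities
is a conjunction of three cases. -/
theorem primrecPred_refutable (n : ℕ) : PrimrecPred (Refutable n) := by
  have hL : Primrec fun m : ℕ => 6 * (m / 6 + 1) :=
    Primrec.nat_mul.comp (Primrec.const 6) (Primrec.succ.comp (primrec_div_const Primrec.id 6))
  have hL' : Primrec fun x : ℕ × ℕ => 6 * (x.1 / 6 + 1) := hL.comp Primrec.fst
  have hNi : PrimrecPred fun x : (ℕ × ℕ) × ℕ => x.1.2.testBit x.2 = true :=
    primrecPred_testBit (Primrec.snd.comp Primrec.fst) Primrec.snd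
  exact primrecPred_exists_lt (primrec_two_pow (primrec_two_pow hL))
    ((primrecPred_forall_lt (primrec_two_pow hL') (primrecPred_imp hNi
      (primrecPred_isWorld n (hL'.comp Primrec.fst) (Primrec.snd.comp Primrec.fst)
        Primrec.snd))).and
    (primrecPred_exists_lt (primrec_two_pow hL') (hNi.and
      (primrecPred_testBit Primrec.snd (Primrec.fst.comp Primrec.fst)).not)))

end Primrec

/-! ### Coded models at the level of formulas -/

section Coding

variable {Ag Var : Type*} {n : ℕ} {eA : Ag ≃ Fin n} {eV : Var ≃ ℕ}

theorem code_box (s : Modality) (a : Ag) (φ : Formula Ag Var) :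
    code eA eV (box s a φ) = 6 * (n * code eA eV φ + eA a) + s.symbol := by
  cases s <;> rfl

theorem Modality.three_le_symbol (s : Modality) : 3 ≤ s.symbol := by
  cases s <;> simp [symbol]

theorem Modality.symbol_lt_six (s : Modality) : s.symbol < 6 := by
  cases s <;> simp [symbol]

theorem Modality.symbol_injective : Function.Injective Modality.symbol := by
  intro s t h
  cases s <;> cases t <;> first | rfl | simp [symbol] at h

theorem code_box_mod (s : Modality) (a : Ag) (φ : Formula Ag Var) :
    code eA eV (box s a φ) % 6 = s.symbol := by
  have := s.symbol_lt_six
  rw [code_box]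
  omega

theorem code_box_div (s : Modality) (a : Ag) (φ : Formula Ag Var) :
    code eA eV (box s a φ) / 6 = n * code eA eV φ + eA a := by
  have := s.symbol_lt_six
  rw [code_box]
  omega

theorem code_box_agent (s : Modality) (a : Ag) (φ : Formula Ag Var) :
    code eA eV (box s a φ) / 6 % n = eA a := by
  rw [code_box_div, Nat.mul_add_mod, Nat.mod_eq_of_lt (eA a).isLt]

theorem code_box_body (s : Modality) (a : Ag) (φ : Formula Ag Var) :
    code eA eV (box s a φ) / 6 / n = code eA eV φ := by
  have ha := (eA a).isLt
  rw [code_box_div, Nat.mul_add_div (by omega), Nat.div_eq_of_lt ha, add_zero]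

/-- This and the next three lemmas make every set of formulas of bounded code closed under
subformulas. -/
theorem code_lt_code_neg (φ : Formula Ag Var) : code eA eV φ < code eA eV (neg φ) := by
  simp only [code]
  omega

theorem code_lt_code_and_left (φ ψ : Formula Ag Var) :
    code eA eV φ < code eA eV (Formula.and φ ψ) := by
  have := Nat.left_le_pair (code eA eV φ) (code eA eV ψ)
  simp only [code]
  omega

theorem code_lt_code_and_right (φ ψ : Formula Ag Var) :
    code eA eV ψ < code eA eV (Formula.and φ ψ) := by
  have := Nat.right_le_pair (code eA eV φ) (code eA eV ψ)
  simp only [code]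
  omega

theorem code_lt_code_box (s : Modality) (a : Ag) (φ : Formula Ag Var) :
    code eA eV φ < code eA eV (box s a φ) := by
  have ha := (eA a).isLt
  have hs := s.three_le_symbol
  have := Nat.le_mul_of_pos_left (code eA eV φ) (show 0 < n by omega)
  rw [code_box]
  omega

/-- The modality affects only the remainder modulo 6, and a multiple of 6 never separates numbers
with the same quotient by 6. This is why `L` is rounded up. -/
theorem code_box_lt {L : ℕ} (hL : 6 ∣ L) {s : Modality} (t : Modality) {a : Ag}
    {φ : Formula Ag Var} (h : code eA eV (box s a φ) < L) : code eA eV (box t a φ) < L := by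
  have := t.symbol_lt_six
  rw [code_box] at h ⊢
  omega

theorem exists_neg_of_code_mod {ψ : Formula Ag Var} (h : code eA eV ψ % 6 = 1) :
    ∃ φ, ψ = neg φ := by
  rcases ψ with p | φ | ⟨φ, χ⟩ | ⟨s, a, φ⟩
  · simp only [code] at h; omega
  · exact ⟨φ, rfl⟩
  · simp only [code] at h; omega
  · rw [code_box_mod] at h; have := s.three_le_symbol; omega

theorem exists_and_of_code_mod {ψ : Formula Ag Var} (h : code eA eV ψ % 6 = 2) :
    ∃ φ χ, ψ = Formula.and φ χ := by
  rcases ψ with p | φ | ⟨φ, χ⟩ | ⟨s, a, φ⟩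
  · simp only [code] at h; omega
  · simp only [code] at h; omega
  · exact ⟨φ, χ, rfl⟩
  · rw [code_box_mod] at h; have := s.three_le_symbol; omega

theorem exists_box_of_code_mod {ψ : Formula Ag Var} (h : 3 ≤ code eA eV ψ % 6) :
    ∃ s a φ, ψ = box s a φ := by
  rcases ψ with p | φ | ⟨φ, χ⟩ | ⟨s, a, φ⟩
  · simp only [code] at h; omega
  · simp only [code] at h; omega
  · simp only [code] at h; omega
  · exact ⟨s, a, φ, rfl⟩

theorem code_neg_div (φ : Formula Ag Var) : code eA eV (neg φ) / 6 = code eA eV φ := by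
  simp only [code]
  omega

theorem code_and_div (φ ψ : Formula Ag Var) :
    code eA eV (Formula.and φ ψ) / 6 = Nat.pair (code eA eV φ) (code eA eV ψ) := by
  simp only [code]
  omega

variable [NeZero n] {L : ℕ}

/-- The symbols of `I` and `K` are 3 and 4, so bit `k + 1` in `Sees` belongs to the knowledge
formula with the same agent and body. The three conclusions mirror `A11`, `A10` and the meaning of
the box. -/
theorem sees_I_iff (a : Ag) (i j : ℕ) :
    Sees n L .I (eA a) i j ↔ ∀ φ : Formula Ag Var, code eA eV (intends a φ) < L →
      i.testBit (code eA eV (intends a φ)) → j.testBit (code eA eV (intends a φ)) ∧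
        j.testBit (code eA eV (knows a φ)) ∧ j.testBit (code eA eV φ) := by
  constructor
  · intro h φ hφ hi
    have := h _ hφ (code_box_mod ..) (code_box_agent ..) hi
    rwa [code_box_body] at this
  · intro h k hk h3 ha hi
    obtain ⟨ψ, rfl⟩ := code_surjective eA eV k
    obtain ⟨s, b, φ, rfl⟩ := exists_box_of_code_mod h3.ge
    rw [code_box_mod] at h3
    obtain rfl : s = .I := Modality.symbol_injective h3
    rw [code_box_agent] at ha
    obtain rfl := eA.injective (Fin.ext ha)
    rw [code_box_body]
    exact h φ hk hi

theorem sees_K_iff (a : Ag) (i j : ℕ) :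
    Sees n L .K (eA a) i j ↔ ∀ s, ∀ φ : Formula Ag Var, code eA eV (box s a φ) < L →
      i.testBit (code eA eV (box s a φ)) → j.testBit (code eA eV (box s a φ)) ∧
        (s = .K → j.testBit (code eA eV φ)) := by
  constructor
  · intro h s φ hφ hi
    have := h _ hφ (by rw [code_box_mod]; exact s.three_le_symbol) (code_box_agent ..) hi
    rw [code_box_body, code_box_mod] at this
    exact ⟨this.1, fun hs => this.2 (by rw [hs]; rfl)⟩
  · intro h k hk h3 ha hi
    obtain ⟨ψ, rfl⟩ := code_surjective eA eV k
    obtain ⟨s, b, φ, rfl⟩ := exists_box_of_code_mod h3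
    rw [code_box_agent] at ha
    obtain rfl := eA.injective (Fin.ext ha)
    rw [code_box_body, code_box_mod]
    exact ⟨(h s φ hk hi).1, fun hs => (h s φ hk hi).2 (Modality.symbol_injective hs)⟩

/-- Boxes of every kind persist because each is known when true and knowledge implies belief; for
the same reason bodies of known formulas are inherited along with those of believed ones. -/
theorem sees_B_iff (a : Ag) (i j : ℕ) :
    Sees n L .B (eA a) i j ↔ ∀ s, ∀ φ : Formula Ag Var, code eA eV (box s a φ) < L →
      i.testBit (code eA eV (box s a φ)) → j.testBit (code eA eV (box s a φ)) ∧
        (s = .K ∨ s = .B → j.testBit (code eA eV φ)) := by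
  constructor
  · intro h s φ hφ hi
    have := h _ hφ (by rw [code_box_mod]; exact s.three_le_symbol) (code_box_agent ..) hi
    rw [code_box_body, code_box_mod] at this
    exact ⟨this.1, fun hs => this.2 (by rcases hs with rfl | rfl <;> simp [Modality.symbol])⟩
  · intro h k hk h3 ha hi
    obtain ⟨ψ, rfl⟩ := code_surjective eA eV k
    obtain ⟨s, b, φ, rfl⟩ := exists_box_of_code_mod h3
    rw [code_box_agent] at ha
    obtain rfl := eA.injective (Fin.ext ha)
    rw [code_box_body, code_box_mod]
    exact ⟨(h s φ hk hi).1, fun hs => (h s φ hk hi).2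
      (hs.imp (fun h => Modality.symbol_injective h) (fun h => Modality.symbol_injective h))⟩

/-- A coded model as a Kripke model. -/
def codedRel (eA : Ag ≃ Fin n) (L N : ℕ) (s : Modality) (a : Ag)
    (i j : {i : ℕ // i < 2 ^ L ∧ N.testBit i}) : Prop :=
  Sees n L s (eA a) i j

/-- Inclusion and composition conditions hold between arbitrary bit patterns, because the relations
transport boxes. Only reflexivity and seriality have to be demanded by `IsWorld`. -/
theorem isFrame_codedRel (eV : Var ≃ ℕ) {N : ℕ} (hL : 6 ∣ L)
    (hN : ∀ i < 2 ^ L, N.testBit i → IsWorld n L N i) : IsFrame (codedRel eA L N) where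
  refl_K a i := (hN i i.2.1 i.2.2).2.2.1 _ (eA a).isLt
  trans_K a i j l hij hjl := by
    simp only [codedRel, sees_K_iff (eV := eV)] at hij hjl ⊢
    exact fun s φ hφ h => hjl s φ hφ (hij s φ hφ h).1
  serial_B a i := by
    obtain ⟨j, hj, hj', h⟩ := (hN i i.2.1 i.2.2).2.2.2.1 _ (eA a).isLt
    exact ⟨⟨j, hj, hj'⟩, h⟩
  B_le_K a i j hij := by
    simp only [codedRel, sees_K_iff (eV := eV), sees_B_iff (eV := eV)] at hij ⊢
    exact fun s φ hφ h => ⟨(hij s φ hφ h).1, fun hs => (hij s φ hφ h).2 (.inl hs)⟩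
  K_B a i j l hij hjl := by
    simp only [codedRel, sees_K_iff (eV := eV), sees_B_iff (eV := eV)] at hij hjl ⊢
    exact fun s φ hφ h => hjl s φ hφ (hij s φ hφ h).1
  serial_I a i := by
    obtain ⟨j, hj, hj', h⟩ := (hN i i.2.1 i.2.2).2.2.2.2.1 _ (eA a).isLt
    exact ⟨⟨j, hj, hj'⟩, h⟩
  K_I a i j l hij hjl := by
    simp only [codedRel, sees_K_iff (eV := eV), sees_I_iff (eV := eV)] at hij hjl ⊢
    exact fun φ hφ h => hjl φ hφ (hij _ φ hφ h).1
  I_K a i j l hij hjl := by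
    simp only [codedRel, sees_K_iff (eV := eV), sees_I_iff (eV := eV)] at hij hjl ⊢
    intro φ hφ h
    -- An `I`-step delivers the knowledge formula itself, and the following `K`-step unpacks its
    -- body.
    have hK := hjl .K φ (code_box_lt hL _ hφ) (hij φ hφ h).2.1
    exact ⟨(hjl .I φ hφ (hij φ hφ h).1).1, hK.1, hK.2 rfl⟩
  trans_I a i j l hij hjl := by
    simp only [codedRel, sees_I_iff (eV := eV)] at hij hjl ⊢
    exact fun φ hφ h => hjl φ hφ (hij φ hφ h).1

/-- The truth lemma. For a box, the last clause of `IsWorld` supplies a witness against each false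
box, while true boxes pass their bodies on by the definition of `Sees`. -/
theorem holds_codedRel_iff {N : ℕ} (hN : ∀ i < 2 ^ L, N.testBit i → IsWorld n L N i)
    (φ : Formula Ag Var) (hφ : code eA eV φ < L) (i : {i : ℕ // i < 2 ^ L ∧ N.testBit i}) :
    Holds (codedRel eA L N) (fun p i => (i : ℕ).testBit (code eA eV (var p))) φ i ↔
      (i : ℕ).testBit (code eA eV φ) := by
  induction φ generalizing i with
  | var p => rfl
  | neg φ ih =>
    have := (hN i i.2.1 i.2.2).1 _ hφ (by simp only [code]; omega)
    rw [this, code_neg_div, Holds, ih ((code_lt_code_neg φ).trans hφ)]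
  | and φ ψ ih₁ ih₂ =>
    have := (hN i i.2.1 i.2.2).2.1 _ hφ (by simp only [code]; omega)
    rw [this, code_and_div, Nat.unpair_pair, Holds, ih₁ ((code_lt_code_and_left φ ψ).trans hφ),
      ih₂ ((code_lt_code_and_right φ ψ).trans hφ)]
  | box s a φ ih =>
    have ih := ih ((code_lt_code_box s a φ).trans hφ)
    simp only [Holds, ih]
    constructor
    · intro h
      refine (hN i i.2.1 i.2.2).2.2.2.2.2 s _ hφ (code_box_mod ..) fun j hj hj' hij => ?_
      rw [code_box_body]
      rw [code_box_agent] at hij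
      exact h ⟨j, hj, hj'⟩ hij
    · intro h j hij
      cases s
      · exact ((sees_I_iff a i j).1 hij φ hφ h).2.2
      · exact ((sees_K_iff a i j).1 hij _ φ hφ h).2 rfl
      · exact ((sees_B_iff a i j).1 hij _ φ hφ h).2 (.inr rfl)

theorem not_provable_of_refutable {φ : Formula Ag Var} (h : Refutable n (code eA eV φ)) :
    ¬ Provable φ := by
  obtain ⟨N, -, hN, i, hi, hNi, hiφ⟩ := h
  intro hφ
  exact hiφ ((holds_codedRel_iff hN φ (by omega) ⟨i, hi, hNi⟩).1
    (hφ.holds (isFrame_codedRel eV ⟨_, rfl⟩ hN) _))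

end Coding

/-! ### Completeness -/

section Completeness

variable {Ag Var : Type*}

theorem Provable.of_tautology₁ {φ ψ : Formula Ag Var} (h : Provable φ)
    (t : ∀ v : Formula Ag Var → Bool, boolEval v φ = true → boolEval v ψ = true) :
    Provable ψ := by
  refine .RMP _ _ h (.A1 _ fun v => ?_)
  have := t v
  simp only [imp, Formula.or, boolEval]
  cases h : boolEval v φ <;> simp_all

theorem Provable.of_tautology₂ {φ ψ χ : Formula Ag Var} (h₁ : Provable φ) (h₂ : Provable ψ)
    (t : ∀ v : Formula Ag Var → Bool, boolEval v φ = true → boolEval v ψ = true →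
      boolEval v χ = true) : Provable χ := by
  refine .RMP _ _ h₂ (h₁.of_tautology₁ fun v h => ?_)
  have := t v h
  simp only [imp, Formula.or, boolEval]
  cases h : boolEval v ψ <;> simp_all

theorem boolEval_imp (v : Formula Ag Var → Bool) (φ ψ : Formula Ag Var) :
    boolEval v (imp φ ψ) = (!boolEval v φ || boolEval v ψ) := by
  simp [imp, Formula.or, boolEval]

theorem Provable.imp_refl (φ : Formula Ag Var) : Provable (imp φ φ) :=
  .A1 _ fun v => by simp [boolEval_imp]

theorem Provable.imp_trans {φ ψ χ : Formula Ag Var} (h₁ : Provable (imp φ ψ))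
    (h₂ : Provable (imp ψ χ)) : Provable (imp φ χ) :=
  h₁.of_tautology₂ h₂ fun v => by
    simp only [boolEval_imp]
    cases boolEval v φ <;> cases boolEval v ψ <;> simp

theorem Provable.imp_and {φ ψ χ : Formula Ag Var} (h₁ : Provable (imp φ ψ))
    (h₂ : Provable (imp φ χ)) : Provable (imp φ (Formula.and ψ χ)) :=
  h₁.of_tautology₂ h₂ fun v => by
    simp only [boolEval_imp, boolEval]
    cases boolEval v φ <;> cases boolEval v ψ <;> simp

theorem Provable.and_imp_left (φ ψ : Formula Ag Var) : Provable (imp (Formula.and φ ψ) φ) :=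
  .A1 _ fun v => by
    simp only [boolEval_imp, boolEval]
    cases boolEval v φ <;> simp

theorem Provable.and_imp_right (φ ψ : Formula Ag Var) : Provable (imp (Formula.and φ ψ) ψ) :=
  .A1 _ fun v => by
    simp only [boolEval_imp, boolEval]
    cases boolEval v ψ <;> simp

theorem Provable.neg_of_not_imp {θ φ : Formula Ag Var} (h₁ : Provable (imp θ φ))
    (h₂ : Provable (imp θ (neg φ))) : Provable (neg θ) :=
  h₁.of_tautology₂ h₂ fun v => by
    simp only [boolEval_imp, boolEval]
    cases boolEval v θ <;> cases boolEval v φ <;> simp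

theorem Provable.box_mono {φ ψ : Formula Ag Var} (s : Modality) (a : Ag)
    (h : Provable (imp φ ψ)) : Provable (imp (box s a φ) (box s a ψ)) :=
  .RMP _ _ (.RN s a _ h) (.A2 s a φ ψ)

theorem Provable.box_and (s : Modality) (a : Ag) {θ φ ψ : Formula Ag Var}
    (h₁ : Provable (imp θ (box s a φ))) (h₂ : Provable (imp θ (box s a ψ))) :
    Provable (imp θ (box s a (Formula.and φ ψ))) := by
  have h : Provable (imp φ (imp ψ (Formula.and φ ψ))) := .A1 _ fun v => by
    simp only [boolEval_imp, boolEval]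
    cases boolEval v φ <;> cases boolEval v ψ <;> rfl
  have h₃ := (h₁.imp_trans (h.box_mono s a)).imp_trans (.A2 s a _ _)
  exact h₃.of_tautology₂ h₂ fun v => by
    simp only [boolEval_imp]
    cases boolEval v θ <;> cases boolEval v (box s a ψ) <;> simp

/-- Necessitation makes the negation of a refutable formula believed, and `A5` forbids believing
both. -/
theorem Provable.seriality_B (a : Ag) {θ φ : Formula Ag Var} (hφ : Provable (neg φ))
    (h : Provable (imp θ (believes a φ))) : Provable (neg θ) :=
  (h.imp_trans (.A5 a φ)).of_tautology₂ (.RN .B a _ hφ) fun v => by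
    simp only [boolEval_imp, boolEval]
    cases boolEval v θ <;> simp_all

theorem Provable.seriality_I (a : Ag) {θ φ : Formula Ag Var} (hφ : Provable (neg φ))
    (h : Provable (imp θ (intends a φ))) : Provable (neg θ) :=
  (h.imp_trans (.A8 a φ)).of_tautology₂ (.RN .I a _ hφ) fun v => by
    simp only [boolEval_imp, boolEval]
    cases boolEval v θ <;> simp_all

/-! ### Complete formulas, their successors and their traces -/

variable {n : ℕ} {eA : Ag ≃ Fin n} {eV : Var ≃ ℕ}

/-- `θ` is consistent and decides all formulas with Gödel number below `L`. -/
structure IsComplete (eA : Ag ≃ Fin n) (eV : Var ≃ ℕ) (L : ℕ) (θ : Formula Ag Var) : Prop where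
  consistent : ¬ Provable (neg θ)
  decides : ∀ φ, code eA eV φ < L → Provable (imp θ φ) ∨ Provable (imp θ (neg φ))

theorem IsComplete.imp_neg_iff {L : ℕ} {θ φ : Formula Ag Var} (hθ : IsComplete eA eV L θ)
    (hφ : code eA eV φ < L) : Provable (imp θ (neg φ)) ↔ ¬ Provable (imp θ φ) :=
  ⟨fun h h' => hθ.consistent (h'.neg_of_not_imp h), fun h => (hθ.decides φ hφ).resolve_left h⟩

variable [NeZero n]

/-- A finite Lindenbaum construction: the coding is bijective, so raising the bound by one adds
exactly one formula to decide, and a conjunct does it. -/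
theorem exists_isComplete (eA : Ag ≃ Fin n) (eV : Var ≃ ℕ) (L : ℕ) {θ : Formula Ag Var}
    (hθ : ¬ Provable (neg θ)) : ∃ θ', IsComplete eA eV L θ' ∧ Provable (imp θ' θ) := by
  induction L with
  | zero => exact ⟨θ, ⟨hθ, fun φ h => absurd h (by omega)⟩, .imp_refl θ⟩
  | succ L ih =>
    obtain ⟨θ', h, hθ'⟩ := ih
    obtain ⟨χ, hχ⟩ := code_surjective eA eV L
    have extend : ∀ ψ, ψ = χ ∨ ψ = neg χ → ¬ Provable (neg (Formula.and θ' ψ)) →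
        ∃ θ', IsComplete eA eV (L + 1) θ' ∧ Provable (imp θ' θ) := by
      intro ψ hψ hcons
      have hl := Provable.and_imp_left θ' ψ
      have hr := Provable.and_imp_right θ' ψ
      refine ⟨Formula.and θ' ψ, ⟨hcons, fun φ hφ => ?_⟩, hl.imp_trans hθ'⟩
      rcases Nat.lt_succ_iff_lt_or_eq.1 hφ with hφ | hφ
      · exact (h.decides φ hφ).imp hl.imp_trans hl.imp_trans
      · obtain rfl := code_injective eA eV (hφ.trans hχ.symm)
        rcases hψ with rfl | rfl
        · exact .inl hr
        · exact .inr hr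
    by_cases hcons : Provable (neg (Formula.and θ' χ))
    · refine extend (neg χ) (.inr rfl) fun hcons' => h.consistent ?_
      exact hcons.of_tautology₂ hcons' fun v => by
        simp only [boolEval]
        cases boolEval v χ <;> simp
    · exact extend χ (.inl rfl) hcons

/-- The finitely many formulas of bounded Gödel number whose necessitation is entailed by `θ` are
entailed by a single formula of this kind. -/
theorem exists_box_conj (eA : Ag ≃ Fin n) (eV : Var ≃ ℕ) (L : ℕ) (s : Modality) (a : Ag)
    (θ : Formula Ag Var) : ∃ γ, Provable (imp θ (box s a γ)) ∧
      ∀ φ, code eA eV φ < L → Provable (imp θ (box s a φ)) → Provable (imp γ φ) := by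
  induction L with
  | zero =>
    -- The empty conjunction; any tautology would serve.
    refine ⟨imp θ θ, ?_, fun φ h => absurd h (by omega)⟩
    exact (Provable.RN s a _ (.imp_refl θ)).of_tautology₁ fun v h => by simp [boolEval_imp, h]
  | succ L ih =>
    obtain ⟨γ, hγ, h⟩ := ih
    obtain ⟨χ, hχ⟩ := code_surjective eA eV L
    by_cases hθ : Provable (imp θ (box s a χ))
    · refine ⟨Formula.and γ χ, hγ.box_and s a hθ, fun φ hφ hθφ => ?_⟩
      rcases Nat.lt_succ_iff_lt_or_eq.1 hφ with hφ | hφ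
      · exact (Provable.and_imp_left γ χ).imp_trans (h φ hφ hθφ)
      · obtain rfl := code_injective eA eV (hφ.trans hχ.symm)
        exact .and_imp_right γ φ
    · refine ⟨γ, hγ, fun φ hφ hθφ => ?_⟩
      rcases Nat.lt_succ_iff_lt_or_eq.1 hφ with hφ | hφ
      · exact h φ hφ hθφ
      · obtain rfl := code_injective eA eV (hφ.trans hχ.symm)
        exact absurd hθφ hθ

/-- If the conjunction `γ` of the boxed consequences were inconsistent with `neg χ`, then `γ` would
imply `χ`, and by monotonicity of the box `θ` would entail the box of `χ`. So this pair is
consistent and extends to a complete formula. -/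
theorem exists_successor (eA : Ag ≃ Fin n) (eV : Var ≃ ℕ) (L : ℕ) {s : Modality} {a : Ag}
    {θ χ : Formula Ag Var} (hθ : ¬ Provable (imp θ (box s a χ))) :
    ∃ θ', IsComplete eA eV L θ' ∧ ¬ Provable (imp θ' χ) ∧
      ∀ φ, code eA eV φ < L → Provable (imp θ (box s a φ)) → Provable (imp θ' φ) := by
  obtain ⟨γ, hγ, h⟩ := exists_box_conj eA eV L s a θ
  obtain ⟨θ', hθ', himp⟩ := exists_isComplete eA eV L (θ := Formula.and γ (neg χ)) fun hc =>
    hθ (hγ.imp_trans (Provable.box_mono s a (hc.of_tautology₁ fun v => by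
      simp only [boolEval_imp, boolEval]
      cases boolEval v γ <;> simp)))
  refine ⟨θ', hθ', fun hχ => hθ'.consistent ?_, fun φ hφ hθφ => ?_⟩
  · exact hχ.neg_of_not_imp (himp.imp_trans (.and_imp_right _ _))
  · exact himp.imp_trans ((Provable.and_imp_left _ _).imp_trans (h φ hφ hθφ))

/-- The bits of `i` record which formulas with Gödel number below `L` are entailed by `θ`. -/
def IsTrace (eA : Ag ≃ Fin n) (eV : Var ≃ ℕ) (L : ℕ) (θ : Formula Ag Var) (i : ℕ) : Prop :=
  ∀ φ, code eA eV φ < L → (i.testBit (code eA eV φ) ↔ Provable (imp θ φ))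

theorem exists_forall_testBit_iff (L : ℕ) (p : ℕ → Prop) :
    ∃ i < 2 ^ L, ∀ k < L, (i.testBit k ↔ p k) := by
  classical
  refine ⟨Nat.ofBits fun k : Fin L => decide (p k), Nat.ofBits_lt_two_pow _, fun k hk => ?_⟩
  simp [Nat.testBit_ofBits_lt _ _ hk]

theorem exists_isTrace (eA : Ag ≃ Fin n) (eV : Var ≃ ℕ) (L : ℕ) (θ : Formula Ag Var) :
    ∃ i < 2 ^ L, IsTrace eA eV L θ i := by
  obtain ⟨i, hi, h⟩ :=
    exists_forall_testBit_iff L fun k => Provable (imp θ ((goedel eA eV).symm k))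
  refine ⟨i, hi, fun φ hφ => ?_⟩
  rw [h _ hφ, show code eA eV φ = goedel eA eV φ from rfl, Equiv.symm_apply_apply]

/-- Canonical accessibility between formulas implies coded accessibility: the introspection axioms
put each required formula under the box `s`, from which `h` releases it. -/
theorem IsTrace.sees {L : ℕ} (hL : 6 ∣ L) {θ θ' : Formula Ag Var} {i j : ℕ}
    (hi : IsTrace eA eV L θ i) (hj : IsTrace eA eV L θ' j) (s : Modality) (a : Ag)
    (h : ∀ φ, code eA eV φ < L → Provable (imp θ (box s a φ)) → Provable (imp θ' φ)) :
    Sees n L s (eA a) i j := by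
  have hK : ∀ t φ, Provable (imp (box t a φ) (knows a (box t a φ)) : Formula Ag Var) := by
    rintro (_ | _ | _) φ
    exacts [.A9 a φ, .A4 a φ, .A7 a φ]
  cases s
  · rw [sees_I_iff (eV := eV)]
    intro φ hφ hiφ
    have hφK := code_box_lt hL .K hφ
    have hφ' := (code_lt_code_box _ _ _).trans hφ
    rw [hi _ hφ] at hiφ
    rw [hj _ hφ, hj _ hφK, hj _ hφ']
    exact ⟨h _ hφ (hiφ.imp_trans (.A11 a φ)), h _ hφK (hiφ.imp_trans (.A10 a φ)), h _ hφ' hiφ⟩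
  · rw [sees_K_iff (eV := eV)]
    intro t φ hφ hiφ
    have hφ' := (code_lt_code_box _ _ _).trans hφ
    rw [hi _ hφ] at hiφ
    rw [hj _ hφ, hj _ hφ']
    exact ⟨h _ hφ (hiφ.imp_trans (hK t φ)), fun ht => h _ hφ' (ht ▸ hiφ)⟩
  · rw [sees_B_iff (eV := eV)]
    intro t φ hφ hiφ
    have hφ' := (code_lt_code_box _ _ _).trans hφ
    rw [hi _ hφ] at hiφ
    rw [hj _ hφ, hj _ hφ']
    refine ⟨h _ hφ ((hiφ.imp_trans (hK t φ)).imp_trans (.A6 a _)), ?_⟩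
    rintro (rfl | rfl)
    · exact h _ hφ' (hiφ.imp_trans (.A6 a φ))
    · exact h _ hφ' hiφ

theorem isWorld_of_isTrace {L N : ℕ} (hL : 6 ∣ L)
    (hN : ∀ i < 2 ^ L, (N.testBit i ↔ ∃ θ, IsComplete eA eV L θ ∧ IsTrace eA eV L θ i))
    {θ : Formula Ag Var} (hθ : IsComplete eA eV L θ) {i : ℕ} (hi : IsTrace eA eV L θ i) :
    IsWorld n L N i := by
  have successor : ∀ (s : Modality) (a : Ag) (χ : Formula Ag Var),
      ¬ Provable (imp θ (box s a χ)) → ∃ j < 2 ^ L, N.testBit j ∧ Sees n L s (eA a) i j ∧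
        (code eA eV χ < L → ¬ j.testBit (code eA eV χ)) := by
    intro s a χ hχ
    obtain ⟨θ', hθ', hθ'χ, h⟩ := exists_successor eA eV L hχ
    obtain ⟨j, hj, hj'⟩ := exists_isTrace eA eV L θ'
    refine ⟨j, hj, (hN j hj).2 ⟨θ', hθ', hj'⟩, hi.sees hL hj' s a h, fun hlt => ?_⟩
    rwa [hj' _ hlt]
  -- A falsum: consistency of `θ` and seriality keep its box from being entailed, so `successor`
  -- yields the required `B`- and `I`-successors.
  have hbot : Provable (neg (Formula.and θ (neg θ))) := .A1 _ fun v => by simp [boolEval]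
  refine ⟨?_, ?_, ?_, ?_, ?_, ?_⟩
  · intro k hk hmod
    obtain ⟨ψ, rfl⟩ := code_surjective eA eV k
    obtain ⟨φ, rfl⟩ := exists_neg_of_code_mod hmod
    have hφ := (code_lt_code_neg _).trans hk
    rw [code_neg_div, hi _ hk, hi _ hφ, hθ.imp_neg_iff hφ]
  · intro k hk hmod
    obtain ⟨ψ, rfl⟩ := code_surjective eA eV k
    obtain ⟨φ, χ, rfl⟩ := exists_and_of_code_mod hmod
    rw [code_and_div, Nat.unpair_pair, hi _ hk, hi _ ((code_lt_code_and_left _ _).trans hk),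
      hi _ ((code_lt_code_and_right _ _).trans hk)]
    exact ⟨fun h => ⟨h.imp_trans (.and_imp_left _ _), h.imp_trans (.and_imp_right _ _)⟩,
      fun h => h.1.imp_and h.2⟩
  · intro a ha
    obtain ⟨a, rfl⟩ : ∃ b, a = eA b := ⟨eA.symm ⟨a, ha⟩, by simp⟩
    exact hi.sees hL hi .K a fun φ _ h => h.imp_trans (.A3 a φ)
  · intro a ha
    obtain ⟨a, rfl⟩ : ∃ b, a = eA b := ⟨eA.symm ⟨a, ha⟩, by simp⟩
    obtain ⟨j, hj, hNj, hij, -⟩ :=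
      successor .B a _ fun h => hθ.consistent (Provable.seriality_B a hbot h)
    exact ⟨j, hj, hNj, hij⟩
  · intro a ha
    obtain ⟨a, rfl⟩ : ∃ b, a = eA b := ⟨eA.symm ⟨a, ha⟩, by simp⟩
    obtain ⟨j, hj, hNj, hij, -⟩ :=
      successor .I a _ fun h => hθ.consistent (Provable.seriality_I a hbot h)
    exact ⟨j, hj, hNj, hij⟩
  · intro s k hk hmod h
    obtain ⟨ψ, rfl⟩ := code_surjective eA eV k
    obtain ⟨t, a, φ, rfl⟩ := exists_box_of_code_mod (hmod ▸ s.three_le_symbol)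
    rw [code_box_mod] at hmod
    obtain rfl := Modality.symbol_injective hmod
    rw [code_box_agent, code_box_body] at h
    rw [hi _ hk]
    by_contra hθφ
    obtain ⟨j, hj, hNj, hij, hjφ⟩ := successor t a φ hθφ
    exact hjφ ((code_lt_code_box _ _ _).trans hk) (h j hj hNj hij)

theorem refutable_of_not_provable {φ : Formula Ag Var} (h : ¬ Provable φ) :
    Refutable n (code eA eV φ) := by
  unfold Refutable
  set L := 6 * (code eA eV φ / 6 + 1) with hL
  -- The canonical choice: all traces of complete formulas are worlds.
  obtain ⟨N, hN, hN'⟩ := exists_forall_testBit_iff (2 ^ L) fun i =>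
    ∃ θ : Formula Ag Var, IsComplete eA eV L θ ∧ IsTrace eA eV L θ i
  refine ⟨N, hN, fun i hi hNi => ?_, ?_⟩
  · obtain ⟨θ, hθ, hθi⟩ := (hN' i hi).1 hNi
    exact isWorld_of_isTrace ⟨_, hL⟩ hN' hθ hθi
  · obtain ⟨θ, hθ, hθφ⟩ := exists_isComplete eA eV L (θ := neg φ) fun hc =>
      h (hc.of_tautology₁ fun v => by simp [boolEval])
    obtain ⟨i, hi, hθi⟩ := exists_isTrace eA eV L θ
    refine ⟨i, hi, (hN' i hi).2 ⟨θ, hθ, hθi⟩, ?_⟩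
    have hφ : code eA eV φ < L := by omega
    rw [hθi _ hφ]
    exact (hθ.imp_neg_iff hφ).1 hθφ

theorem refutable_iff_not_provable (φ : Formula Ag Var) :
    Refutable n (code eA eV φ) ↔ ¬ Provable φ :=
  ⟨not_provable_of_refutable, refutable_of_not_provable⟩

end Completeness

end TrueSecrets

/-- For every nonempty finite set `Ag` of agents and every countably infinite set `Var` of
variables (with arbitrary enumerations of both), the logic `S` is decidable: the set of Gödel
numbers of its theorems is recursive. -/
theorem theorem2 {Ag Var : Type*} [Fintype Ag] [Nonempty Ag]
    (eA : Ag ≃ Fin (Fintype.card Ag)) (eV : Var ≃ ℕ) :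
    ComputablePred (fun m : ℕ =>
      TrueSecrets.Provable ((TrueSecrets.Formula.goedel eA eV).symm m)) :=
  (TrueSecrets.primrecPred_refutable (Fintype.card Ag)).not.computablePred.of_eq fun m => by
    obtain ⟨φ, rfl⟩ := (TrueSecrets.Formula.goedel eA eV).surjective m
    rw [Equiv.symm_apply_apply]
    exact (not_congr (TrueSecrets.refutable_iff_not_provable φ)).trans not_not
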